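/- Let $a>0$, let $H$ be a probability measure on $\mathbb{R}$ whose cumulative distribution function $H(t)=H((-\infty,t])$ is continuous, and let $P$ be a Dirichlet process $DP(a,H)$, i.e. a random probability measure on $\mathbb{R}$ such that for every $k\ge 2$ and every measurable partition $A_1,\dots,A_k$ of $\mathbb{R}$ the vector $(P(A_1),\dots,P(A_k))$ has the Dirichlet distribution with parameters $aH(A_1),\dots,aH(A_k)$ (a coordinate with parameter $0$ being almost surely $0$). Write $P(t)=P((-\infty,t])$ and let $$d_{AD}(P,H)=\int_{-\infty}^{\infty}\frac{(P(t)-H(t))^2}{H(t)(1-H(t))}\,dH(t)\in[0,\infty]$$ be the Anderson–Darling distance between $P$ and $H$. Then $d_{AD}(P,H)$ is almost surely finite and square integrable, and $$E\big(d_{AD}(P,H)\big)=\frac{1}{a+1},\qquad \operatorname{Var}\big(d_{AD}(P,H)\big)=\frac{2\left((\pi^2-9)a^2+(30-2\pi^2)a-3\pi^2+36\right)}{3(a+1)^2(a+2)(a+3)}.$$ -/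

import Mathlib

open MeasureTheory ProbabilityTheory
open scoped ENNReal

noncomputable section

/-- The Gamma distribution with shape `α` and rate `1`, where shape `0` is the point mass at `0`. -/
def gammaLaw (α : ℝ) : Measure ℝ :=
  if 0 < α then gammaMeasure α 1 else Measure.dirac 0

/-- The Dirichlet distribution with parameters `α i ≥ 0` (not all zero): the law of
`(Z i / ∑ j, Z j)` for independent `Z i` with distribution Gamma(`α i`, 1). A coordinate with
parameter `0` is almost surely `0`. -/
def dirichletMeasure {k : ℕ} (α : Fin k → ℝ) : Measure (Fin k → ℝ) :=
  (Measure.pi fun i => gammaLaw (α i)).map fun z i => z i / ∑ j, z j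

/-- `P`, a random element on the probability space `(Ω, μ)`, is a Dirichlet process on `𝔛` with
concentration parameter `a` and base measure `H`: it is a random probability measure, and its
values on each finite measurable partition are jointly Dirichlet distributed. -/
structure IsDirichletProcess {Ω 𝔛 : Type*} [MeasurableSpace Ω] [MeasurableSpace 𝔛]
    (P : Ω → Measure 𝔛) (a : ℝ) (H : Measure 𝔛) (μ : Measure Ω) : Prop where
  /-- every `P(A)`, with `A` measurable, is a random variable -/
  measurable : ∀ A : Set 𝔛, MeasurableSet A → Measurable fun ω => P ω A
  /-- every realization is a probability measure -/
  isProbabilityMeasure : ∀ ω, IsProbabilityMeasure (P ω)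
  /-- the joint law on a measurable partition -/
  hasLaw : ∀ (k : ℕ), 2 ≤ k → ∀ A : Fin k → Set 𝔛, (∀ i, MeasurableSet (A i)) →
    Pairwise (fun i j => Disjoint (A i) (A j)) → (⋃ i, A i) = Set.univ →
    HasLaw (fun ω i => (P ω).real (A i)) (dirichletMeasure fun i => a * H.real (A i)) μ

/-- The Anderson–Darling distance `∫ (F - G)² / (G (1 - G)) dG` between two distribution
functions, with values in `[0, ∞]`. -/
def andersonDarling (F G : StieltjesFunction ℝ) : ℝ≥0∞ :=
  ∫⁻ t, ENNReal.ofReal ((F t - G t) ^ 2) / ENNReal.ofReal (G t * (1 - G t)) ∂G.measure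

end

/-!
Write `F` for the continuous distribution function of `H`, and `D t` for the integrand of the
Anderson–Darling distance at `t`. By Tonelli's theorem the first two moments of the distance are
`∫ E (D t) dH(t)` and `∫∫ E (D s * D t) dH(s) dH(t)`, so they depend only on the law of `P` on the
partitions `(-∞, s], (s, t], (t, ∞)`, which is Dirichlet.

*Moments of the Dirichlet distribution* (`integral_prod_pow_dirichletMeasure`). Writing
`1 / S ^ n` as a mixture of the exponentials `exp (-l S)`, `l > 0`, makes the mixed moments of
`Z i / ∑ j, Z j` factor over the independent Gamma variables. What remains is an integral over `l`
that depends only on the sum of the parameters, and the one-coordinate Dirichlet distribution,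
a point mass at `1`, gives its value.

*The integrands.* One finds `E (D t) = 1 / (a + 1)` for every `t` (`lintegral_adIntegrand`), and for
`s ≤ t` with `u = F s`, `v = F t` the mixed moment `E (D s * D t)` is a linear combination of
`1 / ((1 - u) v)`, `1 / (1 - u) + 1 / v` and `1` (`lintegral_adIntegrand_mul`).

*The double integral.* `F` transports `H` to the uniform distribution on `(0, 1)`
(`map_cdf_eq_restrict_volume`), so the second moment is twice the integral of this combination over
the triangle `0 < u < v < 1`. Only the term `1 / ((1 - u) v)` is not elementary: its integral is
`∑ 1 / (n + 1) ^ 2 = π ^ 2 / 6` (`lintegral_triangle_inv_mul_inv`), the source of `π ^ 2` in the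
variance.
-/

/-! ### Moments of the Gamma and Dirichlet distributions -/

lemma Real.Gamma_add_nat_eq {α : ℝ} (hα : 0 < α) (m : ℕ) :
    Real.Gamma (α + m) = (ascPochhammer ℝ m).eval α * Real.Gamma α := by
  induction m with
  | zero => simp
  | succ m ih =>
    have h : α + m ≠ 0 := by positivity
    rw [ascPochhammer_succ_eval, Nat.cast_succ, ← add_assoc, Real.Gamma_add_one h, ih]
    ring

lemma ascPochhammer_eval_nonneg (m : ℕ) {α : ℝ} (hα : 0 ≤ α) :
    0 ≤ (ascPochhammer ℝ m).eval α := by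
  rcases hα.eq_or_lt with h | h
  · rw [← h, ascPochhammer_eval_zero]; split_ifs <;> norm_num
  · exact (ascPochhammer_pos _ _ h).le

lemma isProbabilityMeasure_gammaLaw (α : ℝ) : IsProbabilityMeasure (gammaLaw α) := by
  unfold gammaLaw
  split_ifs with h
  · exact isProbabilityMeasure_gammaMeasure h one_pos
  · infer_instance

lemma gammaLaw_ae_nonneg (α : ℝ) : ∀ᵐ z ∂gammaLaw α, 0 ≤ z := by
  unfold gammaLaw
  split_ifs with h
  · rw [gammaMeasure, ae_withDensity_iff (by unfold gammaPDF; fun_prop)]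
    refine ae_of_all _ fun z hz => ?_
    by_contra hneg
    exact hz (gammaPDF_of_neg (not_le.1 hneg))
  · simp [ae_dirac_eq]

lemma pi_gammaLaw_ae_nonneg {k : ℕ} (α : Fin k → ℝ) :
    ∀ᵐ z ∂Measure.pi (fun i => gammaLaw (α i)), ∀ i, 0 ≤ z i := by
  have hprob := fun i => isProbabilityMeasure_gammaLaw (α i)
  exact ae_all_iff.2 fun i =>
    (Measure.quasiMeasurePreserving_eval _ i).ae (gammaLaw_ae_nonneg (α i))

lemma gammaLaw_ae_pos {α : ℝ} (hα : 0 < α) : ∀ᵐ z ∂gammaLaw α, 0 < z := by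
  have h0 : ∀ᵐ z ∂gammaLaw α, z ≠ 0 := by
    rw [gammaLaw, if_pos hα]
    exact (withDensity_absolutelyContinuous _ _).ae_le (Measure.ae_ne volume 0)
  filter_upwards [h0, gammaLaw_ae_nonneg α] with z h1 h2
  exact lt_of_le_of_ne h2 h1.symm

/-- The exponentially tilted moments of a Gamma distribution, of shape `0` too. -/
lemma integral_pow_mul_exp_gammaLaw {α : ℝ} (hα : 0 ≤ α) {l : ℝ} (hl : 0 ≤ l) (m : ℕ) :
    Integrable (fun z => z ^ m * Real.exp (-(l * z))) (gammaLaw α) ∧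
      ∫ z, z ^ m * Real.exp (-(l * z)) ∂gammaLaw α =
        (ascPochhammer ℝ m).eval α * (1 + l) ^ (-(α + m)) := by
  rcases hα.eq_or_lt with rfl | hα
  · rw [gammaLaw, if_neg (lt_irrefl _)]
    refine ⟨integrable_dirac (by simp), ?_⟩
    rcases Nat.eq_zero_or_pos m with rfl | hm
    · simp
    · simp [hm.ne']
  · have hval : ∫ z, z ^ m * Real.exp (-(l * z)) ∂gammaLaw α =
        (ascPochhammer ℝ m).eval α * (1 + l) ^ (-(α + m)) := by
      rw [gammaLaw, if_pos hα, gammaMeasure,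
        integral_withDensity_eq_integral_toReal_smul (f := gammaPDF α 1)
          (by unfold gammaPDF; fun_prop)
          (ae_of_all _ fun z => ENNReal.ofReal_lt_top)]
      have hae : (fun z => (gammaPDF α 1 z).toReal • (z ^ m * Real.exp (-(l * z)))) =ᵐ[volume]
          (Set.Ioi 0).indicator fun z =>
            (Real.Gamma α)⁻¹ * (z ^ (α + m - 1) * Real.exp (-((1 + l) * z))) := by
        filter_upwards [Measure.ae_ne volume 0] with z hz
        rw [gammaPDF, ENNReal.toReal_ofReal (gammaPDFReal_nonneg hα one_pos z)]
        rcases hz.lt_or_gt with h | h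
        · simp [gammaPDFReal, h.not_ge, h.le]
        · have e1 : z ^ (α + m - 1) = z ^ (α - 1) * z ^ m := by
            rw [← Real.rpow_natCast, ← Real.rpow_add h]; congr 1; ring
          have e2 : Real.exp (-((1 + l) * z)) = Real.exp (-(1 * z)) * Real.exp (-(l * z)) := by
            rw [← Real.exp_add]; congr 1; ring
          simp only [gammaPDFReal, h.le, if_true, Set.mem_Ioi, h, Set.indicator_of_mem,
            smul_eq_mul, Real.one_rpow, e1, e2]
          ring
      rw [integral_congr_ae hae, integral_indicator measurableSet_Ioi, integral_const_mul,
        Real.integral_rpow_mul_exp_neg_mul_Ioi (by positivity) (by positivity),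
        Real.Gamma_add_nat_eq hα, one_div, Real.inv_rpow (by positivity),
        ← Real.rpow_neg (by positivity)]
      have := (Real.Gamma_pos_of_pos hα).ne'
      field_simp
    refine ⟨Integrable.of_integral_ne_zero ?_, hval⟩
    rw [hval]
    have := ascPochhammer_pos m α hα
    positivity

/-- `1 / S ^ n` is a mixture of the exponentials `exp (-l S)`. -/
lemma lintegral_pow_mul_exp_Ioi {n : ℕ} (hn : n ≠ 0) {S : ℝ} (hS : 0 < S) :
    ∫⁻ l in Set.Ioi (0 : ℝ),
        ENNReal.ofReal ((Real.Gamma n)⁻¹ * l ^ (n - 1) * Real.exp (-(l * S))) =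
      ENNReal.ofReal ((S ^ n)⁻¹) := by
  have hn' : (0 : ℝ) < n := by positivity
  have hG := Real.Gamma_pos_of_pos hn'
  have hval : ∫ l in Set.Ioi (0 : ℝ), (Real.Gamma n)⁻¹ * l ^ (n - 1) * Real.exp (-(l * S)) =
      (S ^ n)⁻¹ := by
    have := Real.integral_rpow_mul_exp_neg_mul_Ioi hn' hS
    have e : ∀ l : ℝ, l ^ ((n : ℝ) - 1) = l ^ (n - 1) := fun l => by
      rw [← Nat.cast_pred (Nat.pos_of_ne_zero hn), Real.rpow_natCast]
    simp_rw [e, mul_comm S] at this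
    simp_rw [mul_assoc]
    rw [integral_const_mul, this, Real.rpow_natCast, one_div, inv_pow]
    field_simp
  rw [← hval, ofReal_integral_eq_lintegral_ofReal]
  · apply Integrable.of_integral_ne_zero
    rw [hval]; positivity
  · filter_upwards [ae_restrict_mem measurableSet_Ioi] with l hl
    have : (0 : ℝ) < l := hl
    positivity

/-- The mixed moments of normalised Gamma variables, up to a constant that depends on the
parameters only through their sum. -/
lemma lintegral_prod_div_sum_pow_gammaLaw {k : ℕ} {α : Fin k → ℝ} (hα : ∀ i, 0 ≤ α i)
    (m : Fin k → ℕ) (hm : ∑ i, m i ≠ 0) :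
    ∫⁻ z, ENNReal.ofReal (∏ i, (z i / ∑ j, z j) ^ m i) ∂Measure.pi (fun i => gammaLaw (α i)) =
      ENNReal.ofReal (∏ i, (ascPochhammer ℝ (m i)).eval (α i)) *
        ∫⁻ l in Set.Ioi (0 : ℝ), ENNReal.ofReal ((Real.Gamma (∑ i, m i : ℕ))⁻¹ *
          l ^ (∑ i, m i - 1) * (1 + l) ^ (-(∑ i, α i + (∑ i, m i : ℕ)))) := by
  set n := ∑ i, m i with hn
  have hprob := fun i => isProbabilityMeasure_gammaLaw (α i)
  have hG := Real.Gamma_pos_of_pos (s := (n : ℝ)) (by positivity)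
  have hnn := pi_gammaLaw_ae_nonneg α
  have step : ∀ᵐ z ∂Measure.pi (fun i => gammaLaw (α i)),
      ENNReal.ofReal (∏ i, (z i / ∑ j, z j) ^ m i) =
        ∫⁻ l in Set.Ioi (0 : ℝ), ENNReal.ofReal ((Real.Gamma n)⁻¹ * l ^ (n - 1)) *
          ENNReal.ofReal (∏ i, z i ^ m i * Real.exp (-(l * z i))) := by
    filter_upwards [hnn] with z hz
    have hS : 0 ≤ ∑ j, z j := Finset.sum_nonneg fun i _ => hz i
    have hprodnn : 0 ≤ ∏ i, z i ^ m i := Finset.prod_nonneg fun i _ => pow_nonneg (hz i) _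
    have hl : ∀ l : ℝ, ∏ i, z i ^ m i * Real.exp (-(l * z i)) =
        (∏ i, z i ^ m i) * Real.exp (-(l * ∑ j, z j)) := fun l => by
      rw [Finset.prod_mul_distrib, ← Real.exp_sum, Finset.sum_neg_distrib, Finset.mul_sum]
    simp_rw [hl, div_pow, Finset.prod_div_distrib, Finset.prod_pow_eq_pow_sum, ← hn]
    have hcongr : ∫⁻ l in Set.Ioi (0 : ℝ), ENNReal.ofReal ((Real.Gamma n)⁻¹ * l ^ (n - 1)) *
          ENNReal.ofReal ((∏ i, z i ^ m i) * Real.exp (-(l * ∑ j, z j))) =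
        ∫⁻ l in Set.Ioi (0 : ℝ), ENNReal.ofReal (∏ i, z i ^ m i) *
          ENNReal.ofReal ((Real.Gamma n)⁻¹ * l ^ (n - 1) * Real.exp (-(l * ∑ j, z j))) := by
      refine setLIntegral_congr_fun measurableSet_Ioi fun l hl => ?_
      have : (0 : ℝ) < l := hl
      rw [← ENNReal.ofReal_mul (by positivity), ← ENNReal.ofReal_mul hprodnn]
      congr 1; ring
    rw [hcongr, lintegral_const_mul _ (by fun_prop)]
    rcases hS.eq_or_lt with h0 | hpos
    · -- all coordinates vanish, and at least one of them carries a positive exponent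
      obtain ⟨i, -, hi⟩ := Finset.exists_ne_zero_of_sum_ne_zero hm
      have hzi : z i = 0 :=
        (Finset.sum_eq_zero_iff_of_nonneg fun i _ => hz i).1 h0.symm i (Finset.mem_univ i)
      have : ∏ i, z i ^ m i = 0 :=
        Finset.prod_eq_zero (Finset.mem_univ i) (by rw [hzi, zero_pow hi])
      simp [this]
    · rw [lintegral_pow_mul_exp_Ioi hm hpos, ← ENNReal.ofReal_mul hprodnn, div_eq_mul_inv]
  rw [lintegral_congr_ae step, lintegral_lintegral_swap (by fun_prop),
    ← lintegral_const_mul _ (by fun_prop)]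
  refine setLIntegral_congr_fun measurableSet_Ioi fun l hl => ?_
  have hl0 : (0 : ℝ) < l := hl
  have hI := fun i => integral_pow_mul_exp_gammaLaw (hα i) hl0.le (m i)
  have hpoch : 0 ≤ ∏ i, (ascPochhammer ℝ (m i)).eval (α i) := Finset.prod_nonneg fun i _ =>
    ascPochhammer_eval_nonneg (m i) (hα i)
  rw [lintegral_const_mul _ (by fun_prop), ← ofReal_integral_eq_lintegral_ofReal,
    integral_fintype_prod_eq_prod (fun i x => x ^ m i * Real.exp (-(l * x)))]
  · simp_rw [fun i => (hI i).2]
    rw [Finset.prod_mul_distrib, ← Real.rpow_sum_of_pos (by positivity), Finset.sum_neg_distrib,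
      Finset.sum_add_distrib, ← Nat.cast_sum, ← hn, ← ENNReal.ofReal_mul (by positivity),
      ← ENNReal.ofReal_mul hpoch]
    congr 1; ring
  · exact Integrable.fintype_prod fun i => (hI i).1
  · filter_upwards [hnn] with z hz
    exact Finset.prod_nonneg fun i _ => mul_nonneg (pow_nonneg (hz i) _) (Real.exp_pos _).le

/-- The constant in the mixed moments, read off from the Dirichlet distribution on one
coordinate, which is the point mass at `1`. -/
lemma lintegral_pow_mul_one_add_rpow {a : ℝ} (ha : 0 < a) {n : ℕ} (hn : n ≠ 0) :
    ∫⁻ l in Set.Ioi (0 : ℝ), ENNReal.ofReal ((Real.Gamma n)⁻¹ *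
        l ^ (n - 1) * (1 + l) ^ (-(a + n))) =
      ENNReal.ofReal (((ascPochhammer ℝ n).eval a)⁻¹) := by
  have hprob := isProbabilityMeasure_gammaLaw a
  have h := lintegral_prod_div_sum_pow_gammaLaw (k := 1) (α := fun _ => a) (fun _ => ha.le)
    (fun _ => n) (by simpa using hn)
  have h1 : ∀ᵐ z ∂Measure.pi (fun _ : Fin 1 => gammaLaw a),
      ENNReal.ofReal (∏ i, (z i / ∑ j, z j) ^ n) = 1 := by
    filter_upwards [(Measure.quasiMeasurePreserving_eval (fun _ : Fin 1 => gammaLaw a) 0).ae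
      (gammaLaw_ae_pos ha)] with z hz
    have hz' : z 0 ≠ 0 := ne_of_gt hz
    simp [hz']
  rw [lintegral_congr_ae h1] at h
  simp only [lintegral_one, measure_univ, Finset.univ_unique, Fin.default_eq_zero,
    Finset.prod_const, Finset.card_singleton, pow_one, Finset.sum_const, one_smul] at h
  rw [ENNReal.ofReal_inv_of_pos (ascPochhammer_pos n a ha)]
  exact ENNReal.eq_inv_of_mul_eq_one_left (by rw [mul_comm]; exact h.symm)

lemma isProbabilityMeasure_dirichletMeasure {k : ℕ} (α : Fin k → ℝ) :
    IsProbabilityMeasure (dirichletMeasure α) := by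
  have hprob := fun i => isProbabilityMeasure_gammaLaw (α i)
  exact Measure.isProbabilityMeasure_map (by fun_prop)

lemma dirichletMeasure_ae_nonneg {k : ℕ} (α : Fin k → ℝ) :
    ∀ᵐ x ∂dirichletMeasure α, ∀ i, 0 ≤ x i := by
  have hprob := fun i => isProbabilityMeasure_gammaLaw (α i)
  rw [dirichletMeasure, ae_map_iff (by fun_prop)
    (by simp only [Set.ofPred_forall]; exact MeasurableSet.iInter fun i =>
      measurableSet_le measurable_const (measurable_pi_apply i))]
  have hnn := pi_gammaLaw_ae_nonneg α
  filter_upwards [hnn] with z hz i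
  exact div_nonneg (hz i) (Finset.sum_nonneg fun i _ => hz i)

/-- The mixed moments of the Dirichlet distribution. -/
lemma integral_prod_pow_dirichletMeasure {k : ℕ} {α : Fin k → ℝ} (hα : ∀ i, 0 ≤ α i)
    (hsum : 0 < ∑ i, α i) (m : Fin k → ℕ) :
    Integrable (fun x => ∏ i, x i ^ m i) (dirichletMeasure α) ∧
      ∫ x, ∏ i, x i ^ m i ∂dirichletMeasure α =
        (∏ i, (ascPochhammer ℝ (m i)).eval (α i)) /
          (ascPochhammer ℝ (∑ i, m i)).eval (∑ i, α i) := by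
  have hprob := isProbabilityMeasure_dirichletMeasure α
  have hpoch : 0 ≤ ∏ i, (ascPochhammer ℝ (m i)).eval (α i) := Finset.prod_nonneg fun i _ =>
    ascPochhammer_eval_nonneg (m i) (hα i)
  by_cases hm : ∑ i, m i = 0
  · have hm' : ∀ i, m i = 0 := by simpa using hm
    simp [hm']
  · have hl : ∫⁻ x, ENNReal.ofReal (∏ i, x i ^ m i) ∂dirichletMeasure α =
        ENNReal.ofReal ((∏ i, (ascPochhammer ℝ (m i)).eval (α i)) /
          (ascPochhammer ℝ (∑ i, m i)).eval (∑ i, α i)) := by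
      rw [dirichletMeasure, lintegral_map (by fun_prop) (by fun_prop),
        lintegral_prod_div_sum_pow_gammaLaw hα m hm, lintegral_pow_mul_one_add_rpow hsum hm,
        ← ENNReal.ofReal_mul hpoch, div_eq_mul_inv]
    have hnn : 0 ≤ᵐ[dirichletMeasure α] fun x => ∏ i, x i ^ m i := by
      filter_upwards [dirichletMeasure_ae_nonneg α] with x hx
      exact Finset.prod_nonneg fun i _ => pow_nonneg (hx i) _
    have hmeas : AEStronglyMeasurable (fun x : Fin k → ℝ => ∏ i, x i ^ m i)
        (dirichletMeasure α) :=
      (Finset.measurable_prod _ fun i _ => (measurable_pi_apply i).pow_const _).aestronglyMeasurable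
    refine ⟨⟨hmeas, ?_⟩, ?_⟩
    · rw [hasFiniteIntegral_iff_ofReal hnn, hl]
      exact ENNReal.ofReal_lt_top
    · rw [integral_eq_lintegral_of_nonneg_ae hnn hmeas, hl, ENNReal.toReal_ofReal]
      exact div_nonneg hpoch (ascPochhammer_pos _ _ hsum).le

/-! ### The distribution function as a map to the unit interval -/

/-- The probability integral transform: a continuous distribution function maps its measure to the
uniform distribution. -/
lemma map_cdf_eq_restrict_volume {H : Measure ℝ} [IsProbabilityMeasure H]
    (hH : Continuous (cdf H)) : H.map (cdf H) = volume.restrict (Set.Ioo 0 1) := by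
  have hm : Measurable (cdf H) := hH.measurable
  have hsurj : ∀ u ∈ Set.Ioo (0 : ℝ) 1, ∃ t, cdf H t = u := fun u hu =>
    mem_range_of_exists_le_of_exists_ge hH
      ((tendsto_cdf_atBot H).eventually_le_const hu.1).exists
      ((tendsto_cdf_atTop H).eventually_const_le hu.2).exists
  have hlow : ∀ u ∈ Set.Ioo (0 : ℝ) 1, ENNReal.ofReal u ≤ H {s | cdf H s ≤ u} := fun u hu => by
    obtain ⟨t, ht⟩ := hsurj u hu
    rw [← ht, ofReal_cdf]
    exact measure_mono fun s hs => monotone_cdf H hs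
  have hupp : ∀ u ∈ Set.Ioo (0 : ℝ) 1, H {s | cdf H s < u} ≤ ENNReal.ofReal u := fun u hu => by
    obtain ⟨t, ht⟩ := hsurj u hu
    rw [← ht, ofReal_cdf]
    refine measure_mono fun s hs => ?_
    by_contra h
    exact absurd (monotone_cdf H (not_le.1 h).le) (not_le.2 hs)
  have heq : ∀ u ∈ Set.Ioo (0 : ℝ) 1, H {s | cdf H s ≤ u} = ENNReal.ofReal u := fun u hu => by
    refine le_antisymm ?_ (hlow u hu)
    -- the bound for `{F < w}` with `w > u` covers `{F ≤ u}`; let `w` decrease to `u`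
    have hlim : Filter.Tendsto ENNReal.ofReal (nhdsWithin u (Set.Ioi u))
        (nhds (ENNReal.ofReal u)) :=
      ENNReal.continuous_ofReal.continuousAt.tendsto.mono_left nhdsWithin_le_nhds
    refine ge_of_tendsto hlim ?_
    filter_upwards [Ioo_mem_nhdsGT hu.2] with w hw
    exact (measure_mono fun s (hs : cdf H s ≤ u) => lt_of_le_of_lt hs hw.1).trans
      (hupp w ⟨hu.1.trans hw.1, hw.2⟩)
  have : IsProbabilityMeasure (H.map (cdf H)) := Measure.isProbabilityMeasure_map hm.aemeasurable
  refine Measure.ext_of_Iic _ _ fun u => ?_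
  rw [Measure.map_apply hm measurableSet_Iic, Measure.restrict_apply measurableSet_Iic]
  change H {s | cdf H s ≤ u} = _
  rcases lt_or_ge 0 u with h0 | h0
  · rcases lt_or_ge u 1 with h1 | h1
    · rw [heq u ⟨h0, h1⟩]
      have : Set.Iic u ∩ Set.Ioo 0 1 = Set.Ioc 0 u := by
        ext x; simp only [Set.mem_inter_iff, Set.mem_Iic, Set.mem_Ioo, Set.mem_Ioc]
        exact ⟨fun h => ⟨h.2.1, h.1⟩, fun h => ⟨h.2, h.1, h.2.trans_lt h1⟩⟩
      rw [this, Real.volume_Ioc, sub_zero]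
    · have e1 : {s | cdf H s ≤ u} = Set.univ :=
        Set.eq_univ_of_forall fun s => (cdf_le_one H s).trans h1
      have e2 : Set.Iic u ∩ Set.Ioo 0 1 = Set.Ioo 0 1 :=
        Set.inter_eq_right.2 fun x hx => hx.2.le.trans h1
      rw [e1, e2, measure_univ, Real.volume_Ioo]; simp
  · have e2 : Set.Iic u ∩ Set.Ioo 0 1 = ∅ := by
      ext x; simp only [Set.mem_inter_iff, Set.mem_Iic, Set.mem_Ioo, Set.mem_empty_iff_false,
        iff_false]
      exact fun h => absurd (h.1.trans h0) (not_le.2 h.2.1)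
    rw [e2, measure_empty, ← nonpos_iff_eq_zero]
    have hlim : Filter.Tendsto ENNReal.ofReal (nhdsWithin 0 (Set.Ioi 0)) (nhds 0) := by
      have := ENNReal.continuous_ofReal.continuousAt (x := 0)
      rw [ContinuousAt, ENNReal.ofReal_zero] at this
      exact this.mono_left nhdsWithin_le_nhds
    refine ge_of_tendsto hlim ?_
    filter_upwards [Ioo_mem_nhdsGT (zero_lt_one' ℝ)] with w hw
    exact (measure_mono fun s (hs : cdf H s ≤ u) => (hs.trans h0).trans hw.1.le).trans
      (heq w hw).le

/-! ### Integration over the square and the triangle -/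

/-- The uniform distribution on the open unit square. -/
noncomputable def unitSquareMeasure : Measure (ℝ × ℝ) :=
  (volume.restrict (Set.Ioo (0 : ℝ) 1)).prod (volume.restrict (Set.Ioo (0 : ℝ) 1))

/-- The uniform distribution on the square, restricted to the triangle `0 < u < v < 1`. -/
noncomputable def triangleMeasure : Measure (ℝ × ℝ) :=
  unitSquareMeasure.restrict {p | p.1 < p.2}

lemma measurableSet_fst_lt_snd : MeasurableSet {p : ℝ × ℝ | p.1 < p.2} :=
  measurableSet_lt measurable_fst measurable_snd

lemma triangleMeasure_ae : ∀ᵐ p ∂triangleMeasure, 0 < p.1 ∧ p.1 < p.2 ∧ p.2 < 1 := by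
  have h : ∀ᵐ p ∂unitSquareMeasure, p ∈ Set.Ioo (0 : ℝ) 1 ×ˢ Set.Ioo (0 : ℝ) 1 := by
    rw [unitSquareMeasure, Measure.prod_restrict]
    exact ae_restrict_mem (measurableSet_Ioo.prod measurableSet_Ioo)
  filter_upwards [ae_restrict_mem measurableSet_fst_lt_snd, ae_restrict_of_ae h] with p h1 h2
  exact ⟨h2.1.1, h1, h2.2.2⟩

lemma lintegral_triangleMeasure {f : ℝ × ℝ → ℝ≥0∞} (hf : Measurable f) :
    ∫⁻ p, f p ∂triangleMeasure =
      ∫⁻ v in Set.Ioo (0 : ℝ) 1, ∫⁻ u in Set.Ioo 0 v, f (u, v) := by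
  rw [triangleMeasure, ← lintegral_indicator measurableSet_fst_lt_snd, unitSquareMeasure,
    lintegral_prod_symm' _ (hf.indicator measurableSet_fst_lt_snd)]
  refine setLIntegral_congr_fun measurableSet_Ioo fun v hv => ?_
  have : ∀ u, {p : ℝ × ℝ | p.1 < p.2}.indicator f (u, v) =
      (Set.Iio v).indicator (fun u => f (u, v)) u := fun u => by
    simp [Set.indicator_apply]
  simp_rw [this]
  rw [lintegral_indicator measurableSet_Iio, Measure.restrict_restrict measurableSet_Iio]
  congr 2
  ext x; simp only [Set.mem_inter_iff, Set.mem_Iio, Set.mem_Ioo]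
  exact ⟨fun h => ⟨h.2.1, h.1⟩, fun h => ⟨h.2, h.1, h.2.trans hv.2⟩⟩

lemma lintegral_triangleMeasure' {f : ℝ × ℝ → ℝ≥0∞} (hf : Measurable f) :
    ∫⁻ p, f p ∂triangleMeasure =
      ∫⁻ u in Set.Ioo (0 : ℝ) 1, ∫⁻ v in Set.Ioo u 1, f (u, v) := by
  rw [triangleMeasure, ← lintegral_indicator measurableSet_fst_lt_snd, unitSquareMeasure,
    lintegral_prod _ (hf.indicator measurableSet_fst_lt_snd).aemeasurable]
  refine setLIntegral_congr_fun measurableSet_Ioo fun u hu => ?_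
  have : ∀ v, {p : ℝ × ℝ | p.1 < p.2}.indicator f (u, v) =
      (Set.Ioi u).indicator (fun v => f (u, v)) v := fun v => by
    simp [Set.indicator_apply]
  simp_rw [this]
  rw [lintegral_indicator measurableSet_Ioi, Measure.restrict_restrict measurableSet_Ioi]
  congr 2
  ext x; simp only [Set.mem_inter_iff, Set.mem_Ioi, Set.mem_Ioo]
  exact ⟨fun h => ⟨h.1, h.2.2⟩, fun h => ⟨h.1, hu.1.trans h.1, h.2⟩⟩

/-- A symmetric function integrates over the square to twice its integral over the triangle. -/
lemma lintegral_unitSquareMeasure_of_symm {k : ℝ × ℝ → ℝ≥0∞} (hk : Measurable k)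
    (hsymm : ∀ p, k p.swap = k p) :
    ∫⁻ p, k p ∂unitSquareMeasure = 2 * ∫⁻ p, k p ∂triangleMeasure := by
  have hne : ∀ᵐ p ∂unitSquareMeasure, p.1 ≠ p.2 := by
    rw [unitSquareMeasure, Measure.ae_prod_iff_ae_ae (p := fun p : ℝ × ℝ => p.1 ≠ p.2)
      (measurableSet_eq_fun measurable_fst measurable_snd).compl]
    refine ae_of_all _ fun u => ?_
    filter_upwards [Measure.ae_ne (volume.restrict (Set.Ioo (0 : ℝ) 1)) u] with v hv
    exact hv.symm
  have hsplit : k =ᵐ[unitSquareMeasure] fun p =>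
      {p | p.1 < p.2}.indicator k p + {p | p.1 < p.2}.indicator k p.swap := by
    filter_upwards [hne] with p hp
    rcases hp.lt_or_gt with h | h
    · simp [h, h.not_gt]
    · simp only [Set.indicator_apply, Set.mem_ofPred_eq, h.not_gt, if_false, Prod.fst_swap,
        Prod.snd_swap, h, if_true, hsymm, zero_add]
  have hind := hk.indicator measurableSet_fst_lt_snd
  have hswap : ∫⁻ p, {p | p.1 < p.2}.indicator k p.swap ∂unitSquareMeasure =
      ∫⁻ p, {p | p.1 < p.2}.indicator k p ∂unitSquareMeasure := by
    rw [unitSquareMeasure, lintegral_prod_swap]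
  rw [lintegral_congr_ae hsplit, lintegral_add_left hind, hswap,
    lintegral_indicator measurableSet_fst_lt_snd, two_mul, triangleMeasure]

lemma lintegral_Ioo_ofReal {f : ℝ → ℝ} {x y : ℝ} (hxy : x ≤ y)
    (hf : IntervalIntegrable f volume x y) (h0 : ∀ u ∈ Set.Ioo x y, 0 ≤ f u) :
    ∫⁻ u in Set.Ioo x y, ENNReal.ofReal (f u) = ENNReal.ofReal (∫ u in x..y, f u) := by
  rw [intervalIntegral.integral_of_le hxy, integral_Ioc_eq_integral_Ioo,
    ofReal_integral_eq_lintegral_ofReal]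
  · exact ((intervalIntegrable_iff_integrableOn_Ioo_of_le hxy).1 hf)
  · filter_upwards [ae_restrict_mem measurableSet_Ioo] with u hu using h0 u hu

lemma tsum_ofReal_one_div_add_one_sq :
    ∑' n : ℕ, ENNReal.ofReal (1 / ((n : ℝ) + 1) ^ 2) = ENNReal.ofReal (Real.pi ^ 2 / 6) := by
  have h := (hasSum_nat_add_iff' 1).2 hasSum_zeta_two
  simp only [Finset.range_one, Finset.sum_singleton, Nat.cast_zero, ne_eq, OfNat.ofNat_ne_zero,
    not_false_eq_true, zero_pow, div_zero, sub_zero, Nat.cast_add, Nat.cast_one] at h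
  rw [← h.tsum_eq, ENNReal.ofReal_tsum_of_nonneg (fun n => by positivity) h.summable]

/-- Expanding `1 / (1 - u)` as a geometric series turns this integral into `∑ 1 / (n + 1) ^ 2`. -/
lemma lintegral_triangle_inv_mul_inv :
    ∫⁻ p, ENNReal.ofReal ((1 - p.1)⁻¹ * p.2⁻¹) ∂triangleMeasure =
      ENNReal.ofReal (Real.pi ^ 2 / 6) := by
  rw [lintegral_triangleMeasure (by fun_prop), ← tsum_ofReal_one_div_add_one_sq]
  have h1 : ∀ v ∈ Set.Ioo (0 : ℝ) 1,
      ∫⁻ u in Set.Ioo 0 v, ENNReal.ofReal ((1 - u)⁻¹ * v⁻¹) =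
        ∑' n : ℕ, ENNReal.ofReal (v ^ n * (1 / ((n : ℝ) + 1))) := fun v hv => by
    have e : ∀ u ∈ Set.Ioo 0 v, ENNReal.ofReal ((1 - u)⁻¹ * v⁻¹) =
        ∑' n : ℕ, ENNReal.ofReal (u ^ n * v⁻¹) := fun u hu => by
      have hv0 := hv.1
      have hu0 := hu.1
      have hs := (hasSum_geometric_of_lt_one hu.1.le (hu.2.trans hv.2)).mul_right v⁻¹
      rw [← hs.tsum_eq, ENNReal.ofReal_tsum_of_nonneg (fun n => by positivity) hs.summable]
    rw [setLIntegral_congr_fun measurableSet_Ioo e, lintegral_tsum (fun n => by fun_prop)]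
    refine tsum_congr fun n => ?_
    have hv0 := hv.1
    rw [lintegral_Ioo_ofReal hv.1.le (by apply Continuous.intervalIntegrable; fun_prop)
      (fun u hu => by have := hu.1; positivity)]
    congr 1
    rw [intervalIntegral.integral_mul_const, integral_pow]
    field_simp
    simp [pow_succ']
  rw [setLIntegral_congr_fun measurableSet_Ioo h1, lintegral_tsum (fun n => by fun_prop)]
  refine tsum_congr fun n => ?_
  rw [lintegral_Ioo_ofReal zero_le_one (by apply Continuous.intervalIntegrable; fun_prop)
    (fun u hu => by have := hu.1; positivity)]
  congr 1
  rw [intervalIntegral.integral_mul_const, integral_pow]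
  field_simp
  simp

lemma lintegral_triangle_inv_snd :
    ∫⁻ p, ENNReal.ofReal (p.2⁻¹) ∂triangleMeasure = ENNReal.ofReal 1 := by
  rw [lintegral_triangleMeasure (by fun_prop)]
  have h : ∀ v ∈ Set.Ioo (0 : ℝ) 1, ∫⁻ _ in Set.Ioo 0 v, ENNReal.ofReal (v⁻¹) = 1 :=
    fun v hv => by
      rw [setLIntegral_const, Real.volume_Ioo, sub_zero,
        ← ENNReal.ofReal_mul (inv_nonneg.2 hv.1.le),
        inv_mul_cancel₀ hv.1.ne', ENNReal.ofReal_one]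
  rw [setLIntegral_congr_fun measurableSet_Ioo h, setLIntegral_one, Real.volume_Ioo, sub_zero]

lemma lintegral_triangle_inv_one_sub_fst :
    ∫⁻ p, ENNReal.ofReal ((1 - p.1)⁻¹) ∂triangleMeasure = ENNReal.ofReal 1 := by
  rw [lintegral_triangleMeasure' (by fun_prop)]
  have h : ∀ u ∈ Set.Ioo (0 : ℝ) 1, ∫⁻ _ in Set.Ioo u 1, ENNReal.ofReal ((1 - u)⁻¹) = 1 :=
    fun u hu => by
      have : 0 < 1 - u := sub_pos.2 hu.2
      rw [setLIntegral_const, Real.volume_Ioo, ← ENNReal.ofReal_mul (inv_nonneg.2 this.le),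
        inv_mul_cancel₀ this.ne', ENNReal.ofReal_one]
  rw [setLIntegral_congr_fun measurableSet_Ioo h, setLIntegral_one, Real.volume_Ioo, sub_zero]

lemma lintegral_triangle_one :
    ∫⁻ _, ENNReal.ofReal 1 ∂triangleMeasure = ENNReal.ofReal (1 / 2) := by
  rw [lintegral_triangleMeasure (by fun_prop)]
  have h : ∀ v ∈ Set.Ioo (0 : ℝ) 1, ∫⁻ _ in Set.Ioo 0 v, ENNReal.ofReal 1 = ENNReal.ofReal v :=
    fun v hv => by
      rw [ENNReal.ofReal_one, setLIntegral_one, Real.volume_Ioo, sub_zero]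
  rw [setLIntegral_congr_fun measurableSet_Ioo h,
    lintegral_Ioo_ofReal zero_le_one (by apply Continuous.intervalIntegrable; fun_prop)
    (fun u hu => hu.1.le), integral_id]
  norm_num

lemma integrable_and_integral_of_lintegral_ofReal {α : Type*} [MeasurableSpace α] {ν : Measure α}
    {f : α → ℝ} (hf : Measurable f) (h0 : 0 ≤ᵐ[ν] f) {c : ℝ} (hc : 0 ≤ c)
    (h : ∫⁻ x, ENNReal.ofReal (f x) ∂ν = ENNReal.ofReal c) :
    Integrable f ν ∧ ∫ x, f x ∂ν = c := by
  refine ⟨⟨hf.aestronglyMeasurable, ?_⟩, ?_⟩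
  · rw [hasFiniteIntegral_iff_ofReal h0, h]; exact ENNReal.ofReal_lt_top
  · rw [integral_eq_lintegral_of_nonneg_ae h0 hf.aestronglyMeasurable, h, ENNReal.toReal_ofReal hc]

lemma integral_triangle_combination (x y z : ℝ) :
    Integrable (fun p : ℝ × ℝ => x * ((1 - p.1)⁻¹ * p.2⁻¹) + y * ((1 - p.1)⁻¹ + p.2⁻¹) + z)
      triangleMeasure ∧
    ∫ p, x * ((1 - p.1)⁻¹ * p.2⁻¹) + y * ((1 - p.1)⁻¹ + p.2⁻¹) + z ∂triangleMeasure =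
      x * (Real.pi ^ 2 / 6) + 2 * y + z / 2 := by
  obtain ⟨i1, e1⟩ := integrable_and_integral_of_lintegral_ofReal (by fun_prop)
    (triangleMeasure_ae.mono fun p h => by
      have := h.1; have := h.2.1; have : 0 < 1 - p.1 := by linarith [h.2.2]
      have : 0 < p.2 := by linarith
      simp only [Pi.zero_apply]; positivity) (by positivity) lintegral_triangle_inv_mul_inv
  obtain ⟨i2, e2⟩ := integrable_and_integral_of_lintegral_ofReal (by fun_prop)
    (triangleMeasure_ae.mono fun p h => by
      have := h.1; have := h.2.1; have : 0 < 1 - p.1 := by linarith [h.2.2]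
      simp only [Pi.zero_apply]; positivity) (by positivity) lintegral_triangle_inv_one_sub_fst
  obtain ⟨i3, e3⟩ := integrable_and_integral_of_lintegral_ofReal (by fun_prop)
    (triangleMeasure_ae.mono fun p h => by
      have : 0 < p.2 := by linarith [h.1, h.2.1]
      simp only [Pi.zero_apply]; positivity) (by positivity) lintegral_triangle_inv_snd
  obtain ⟨i4, e4⟩ := integrable_and_integral_of_lintegral_ofReal (ν := triangleMeasure)
    (f := fun _ => 1) (by fun_prop) (ae_of_all _ fun p => zero_le_one) (by positivity)
    lintegral_triangle_one
  have i4' : Integrable (fun _ : ℝ × ℝ => z) triangleMeasure := by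
    simpa using i4.const_mul z
  have e4' : ∫ _, z ∂triangleMeasure = z / 2 := by
    have := integral_const_mul (μ := triangleMeasure) z (fun _ => (1 : ℝ))
    rw [e4] at this
    simpa [div_eq_mul_inv] using this
  have i23 : Integrable (fun p : ℝ × ℝ => y * ((1 - p.1)⁻¹ + p.2⁻¹)) triangleMeasure :=
    (i2.add i3).const_mul y
  have i12 : Integrable (fun p : ℝ × ℝ => x * ((1 - p.1)⁻¹ * p.2⁻¹) +
    y * ((1 - p.1)⁻¹ + p.2⁻¹)) triangleMeasure := (i1.const_mul x).add i23
  refine ⟨i12.add i4', ?_⟩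
  rw [integral_add i12 i4', integral_add (i1.const_mul x) i23,
    integral_const_mul, integral_const_mul, integral_add i2 i3, e1, e2, e3, e4']
  ring

/-! ### Central moments of the outer coordinates of a Dirichlet vector -/

/-- The expectation of a product of two quadratic polynomials, with coefficients `c` and `d`, in
the first and the last coordinate. -/
lemma integral_sum_pow_mul_pow_dirichletMeasure {a : ℝ} (ha : 0 < a) {α : Fin 3 → ℝ}
    (hα : ∀ i, 0 ≤ α i) (hsum : ∑ i, α i = a) (c d : Fin 3 → ℝ) :
    Integrable (fun x => ∑ i : Fin 3, ∑ j : Fin 3, c i * d j * (x 0 ^ (i : ℕ) * x 2 ^ (j : ℕ)))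
        (dirichletMeasure α) ∧
      ∫ x, ∑ i : Fin 3, ∑ j : Fin 3, c i * d j * (x 0 ^ (i : ℕ) * x 2 ^ (j : ℕ))
          ∂dirichletMeasure α =
        ∑ i : Fin 3, ∑ j : Fin 3, c i * d j *
          ((ascPochhammer ℝ i).eval (α 0) * (ascPochhammer ℝ j).eval (α 2) /
            (ascPochhammer ℝ (i + j)).eval a) := by
  have h := fun i j : Fin 3 =>
    integral_prod_pow_dirichletMeasure hα (hsum ▸ ha) ![(i : ℕ), 0, (j : ℕ)]
  simp only [hsum, Fin.prod_univ_three, Fin.sum_univ_three, Matrix.cons_val_zero,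
    Matrix.cons_val_one, Matrix.cons_val, pow_zero, mul_one, add_zero, ascPochhammer_zero,
    Polynomial.eval_one] at h
  have hi : ∀ i j : Fin 3, Integrable
      (fun x : Fin 3 → ℝ => c i * d j * (x 0 ^ (i : ℕ) * x 2 ^ (j : ℕ)))
      (dirichletMeasure α) := fun i j => (h i j).1.const_mul _
  refine ⟨integrable_finsetSum _ fun i _ => integrable_finsetSum _ fun j _ => hi i j, ?_⟩
  rw [integral_finsetSum _ fun i _ => integrable_finsetSum _ fun j _ => hi i j]
  refine Finset.sum_congr rfl fun i _ => ?_
  rw [integral_finsetSum _ fun j _ => hi i j]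
  refine Finset.sum_congr rfl fun j _ => ?_
  rw [integral_const_mul, (h i j).2]

/-- The variance of the first coordinate, with mean `p`. -/
lemma lintegral_sq_dirichletMeasure {a p : ℝ} (ha : 0 < a) {α : Fin 3 → ℝ}
    (hα : ∀ i, 0 ≤ α i) (hsum : ∑ i, α i = a) (h0 : α 0 = a * p) :
    ∫⁻ x, ENNReal.ofReal ((x 0 - p) ^ 2) ∂dirichletMeasure α =
      ENNReal.ofReal (p * (1 - p) / (a + 1)) := by
  obtain ⟨hi, he⟩ := integral_sum_pow_mul_pow_dirichletMeasure ha hα hsum ![p ^ 2, -2 * p, 1]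
    ![1, 0, 0]
  have hf : (fun x : Fin 3 → ℝ => ∑ i : Fin 3, ∑ j : Fin 3,
      (![p ^ 2, -2 * p, 1] : Fin 3 → ℝ) i * (![1, 0, 0] : Fin 3 → ℝ) j *
        (x 0 ^ (i : ℕ) * x 2 ^ (j : ℕ))) = fun x => (x 0 - p) ^ 2 := by
    funext x
    simp [Fin.sum_univ_three]
    ring
  rw [hf] at hi he
  rw [← ofReal_integral_eq_lintegral_ofReal hi (ae_of_all _ fun x => sq_nonneg _), he]
  congr 1
  simp [Fin.sum_univ_three, ascPochhammer_succ_eval, h0]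
  field_simp
  ring

/-- The value of `E ((X - p)² (Z - r)²)` for the outer coordinates `X`, `Z` of a
Dirichlet vector with means `p` and `r`. -/
lemma lintegral_sq_mul_sq_dirichletMeasure {a p r : ℝ} (ha : 0 < a) {α : Fin 3 → ℝ}
    (hα : ∀ i, 0 ≤ α i) (hsum : ∑ i, α i = a) (h0 : α 0 = a * p) (h2 : α 2 = a * r) :
    ∫⁻ x, ENNReal.ofReal ((x 0 - p) ^ 2 * (x 2 - r) ^ 2) ∂dirichletMeasure α =
      ENNReal.ofReal (p * r * (a + (6 - a) * (p + r) - 3 * (6 - a) * (p * r)) /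
        ((a + 1) * (a + 2) * (a + 3))) := by
  obtain ⟨hi, he⟩ := integral_sum_pow_mul_pow_dirichletMeasure ha hα hsum ![p ^ 2, -2 * p, 1]
    ![r ^ 2, -2 * r, 1]
  have hf : (fun x : Fin 3 → ℝ => ∑ i : Fin 3, ∑ j : Fin 3,
      (![p ^ 2, -2 * p, 1] : Fin 3 → ℝ) i * (![r ^ 2, -2 * r, 1] : Fin 3 → ℝ) j *
        (x 0 ^ (i : ℕ) * x 2 ^ (j : ℕ))) = fun x => (x 0 - p) ^ 2 * (x 2 - r) ^ 2 := by
    funext x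
    simp [Fin.sum_univ_three]
    ring
  rw [hf] at hi he
  rw [← ofReal_integral_eq_lintegral_ofReal hi (ae_of_all _ fun x => by positivity), he]
  congr 1
  simp [Fin.sum_univ_three, ascPochhammer_succ_eval, h0, h2]
  field_simp
  ring

/-! ### The integrand of the Anderson–Darling distance -/

/-- The integrand of the Anderson–Darling distance between a random measure and `H`. -/
noncomputable def adIntegrand {Ω : Type*} (P : Ω → Measure ℝ) (H : Measure ℝ) (ω : Ω) (t : ℝ) :
    ℝ≥0∞ :=
  ENNReal.ofReal ((cdf (P ω) t - cdf H t) ^ 2) / ENNReal.ofReal (cdf H t * (1 - cdf H t))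

lemma adIntegrand_eq_ofReal {Ω : Type*} {P : Ω → Measure ℝ} {H : Measure ℝ} (ω : Ω) {t : ℝ}
    (ht : cdf H t ∈ Set.Ioo (0 : ℝ) 1) :
    adIntegrand P H ω t =
      ENNReal.ofReal ((cdf (P ω) t - cdf H t) ^ 2 / (cdf H t * (1 - cdf H t))) := by
  have h1 : 0 < 1 - cdf H t := sub_pos.2 ht.2
  rw [adIntegrand, ENNReal.ofReal_div_of_pos (mul_pos ht.1 h1)]

lemma andersonDarling_eq_lintegral_adIntegrand {Ω : Type*} {P : Ω → Measure ℝ} {H : Measure ℝ}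
    [IsProbabilityMeasure H] (ω : Ω) :
    andersonDarling (cdf (P ω)) (cdf H) = ∫⁻ t, adIntegrand P H ω t ∂H := by
  rw [andersonDarling, measure_cdf]; rfl

/-- Joint measurability, from viewing `P` as a Markov kernel evaluated on the measurable set of
pairs `x ≤ t`. -/
lemma measurable_adIntegrand {Ω : Type*} [MeasurableSpace Ω] {μ : Measure Ω} {a : ℝ}
    {P : Ω → Measure ℝ} {H : Measure ℝ} (hP : IsDirichletProcess P a H μ) :
    Measurable (Function.uncurry (adIntegrand P H)) := by
  let κ : Kernel Ω ℝ := ⟨P, Measure.measurable_of_measurable_coe _ hP.measurable⟩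
  have hprob := hP.isProbabilityMeasure
  have : IsMarkovKernel κ := ⟨hP.isProbabilityMeasure⟩
  have h1 : Measurable fun q : Ω × ℝ => cdf (P q.1) q.2 := by
    have h := Kernel.measurable_kernel_prodMk_left (κ := κ.comap (Prod.fst : Ω × ℝ → Ω)
      measurable_fst) (t := {y | y.2 ≤ y.1.2})
      (measurableSet_le measurable_snd (measurable_snd.comp measurable_fst))
    simp_rw [cdf_eq_real, measureReal_def]
    exact h.ennreal_toReal
  have h2 : Measurable fun q : Ω × ℝ => cdf H q.2 := (monotone_cdf H).measurable.comp measurable_snd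
  exact ((h1.sub h2).pow_const 2).ennreal_ofReal.div
    (h2.mul (measurable_const.sub h2)).ennreal_ofReal

/-- The value of `E (D s * D t)` for the integrand `D`, as a function of `u = F s` and
`v = F t` with `u ≤ v`, where `F` is the distribution function of `H`. -/
noncomputable def adMixedMoment (a u v : ℝ) : ℝ :=
  (2 * a - 6) / ((a + 1) * (a + 2) * (a + 3)) * ((1 - u)⁻¹ * v⁻¹) +
    2 * (6 - a) / ((a + 1) * (a + 2) * (a + 3)) * ((1 - u)⁻¹ + v⁻¹) +
    -3 * (6 - a) / ((a + 1) * (a + 2) * (a + 3))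

/-- Dividing the fourth-order central moment, with `p = u` and `r = 1 - v`, by the weights
`u (1 - u)` and `v (1 - v)` gives `adMixedMoment`. -/
lemma adMixedMoment_eq {a : ℝ} {u v : ℝ} (hu : 0 < u) (hu1 : u < 1)
    (hv : 0 < v) (hv1 : v < 1) :
    u * (1 - v) * (a + (6 - a) * (u + (1 - v)) - 3 * (6 - a) * (u * (1 - v))) /
        ((a + 1) * (a + 2) * (a + 3)) / (u * (1 - u) * (v * (1 - v))) =
      adMixedMoment a u v := by
  have h1 : 1 - u ≠ 0 := by linarith
  have h2 : 1 - v ≠ 0 := by linarith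
  unfold adMixedMoment
  generalize (a + 1) * (a + 2) * (a + 3) = D
  rcases eq_or_ne D 0 with rfl | hD
  · simp
  field_simp
  ring

lemma adMixedMoment_nonneg {a : ℝ} (ha : 0 < a) {u v : ℝ} (hu : 0 < u) (huv : u ≤ v)
    (hv1 : v < 1) : 0 ≤ adMixedMoment a u v := by
  rw [← adMixedMoment_eq hu (by linarith) (by linarith) hv1]
  have h1 : 0 < 1 - u := by linarith
  have h2 : 0 < 1 - v := by linarith
  have h3 : 0 < v := by linarith
  have h4 : 0 ≤ a + (6 - a) * (u + (1 - v)) - 3 * (6 - a) * (u * (1 - v)) := by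
    -- split by powers of `a`, with `p = u`, `r = 1 - v`: `p + r ≤ 1` and `4 p r ≤ (p + r) ^ 2`
    have e1 : 0 ≤ a * (1 - u - (1 - v) + 3 * (u * (1 - v))) :=
      mul_nonneg ha.le (by nlinarith [mul_pos hu h2])
    have e2 : 0 ≤ u + (1 - v) - 3 * (u * (1 - v)) := by
      nlinarith [sq_nonneg (u - (1 - v)), mul_pos hu h2]
    nlinarith
  positivity

/-- The symmetric extension of `adMixedMoment` to the unit square. -/
noncomputable def symmAdMixedMoment (a : ℝ) (p : ℝ × ℝ) : ℝ≥0∞ :=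
  ENNReal.ofReal (adMixedMoment a (min p.1 p.2) (max p.1 p.2))

lemma measurable_symmAdMixedMoment (a : ℝ) : Measurable (symmAdMixedMoment a) := by
  unfold symmAdMixedMoment adMixedMoment
  fun_prop

lemma lintegral_symmAdMixedMoment {a : ℝ} (ha : 0 < a) :
    ∫⁻ p, symmAdMixedMoment a p ∂unitSquareMeasure =
      ENNReal.ofReal (2 * ((2 * a - 6) * (Real.pi ^ 2 / 6) + 5 / 2 * (6 - a)) /
        ((a + 1) * (a + 2) * (a + 3))) := by
  have htri : ∫⁻ p, symmAdMixedMoment a p ∂triangleMeasure =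
      ∫⁻ p, ENNReal.ofReal (adMixedMoment a p.1 p.2) ∂triangleMeasure :=
    lintegral_congr_ae (triangleMeasure_ae.mono fun p hp => by
      simp only [symmAdMixedMoment, min_eq_left hp.2.1.le, max_eq_right hp.2.1.le])
  obtain ⟨hi, he⟩ : Integrable (fun p : ℝ × ℝ => adMixedMoment a p.1 p.2) triangleMeasure ∧
      ∫ p, adMixedMoment a p.1 p.2 ∂triangleMeasure = _ :=
    integral_triangle_combination _ _ _
  rw [lintegral_unitSquareMeasure_of_symm (measurable_symmAdMixedMoment a) (fun p => by
      simp only [symmAdMixedMoment, Prod.fst_swap, Prod.snd_swap, min_comm p.2, max_comm p.2]),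
    htri,
    ← ofReal_integral_eq_lintegral_ofReal hi (triangleMeasure_ae.mono fun p hp =>
      adMixedMoment_nonneg ha hp.1 hp.2.1.le hp.2.2),
    he, ← ENNReal.ofReal_ofNat 2, ← ENNReal.ofReal_mul (by norm_num)]
  congr 1
  field_simp
  ring

section DirichletProcess

variable {Ω : Type*} [MeasurableSpace Ω] {μ : Measure Ω} {a : ℝ} {H : Measure ℝ}
  [IsProbabilityMeasure H] {P : Ω → Measure ℝ}

/-- The joint law on the partition `(-∞, s], (s, t], (t, ∞)`, the middle cell of which is empty
for `s = t`. -/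
lemma IsDirichletProcess.hasLaw_Iic_Ioc_Ioi (hP : IsDirichletProcess P a H μ) (ha : 0 < a)
    {s t : ℝ} (hst : s ≤ t) :
    ∃ α : Fin 3 → ℝ, (∀ i, 0 ≤ α i) ∧ ∑ i, α i = a ∧ α 0 = a * cdf H s ∧
      α 2 = a * (1 - cdf H t) ∧
      HasLaw (fun ω => ![cdf (P ω) s, cdf (P ω) t - cdf (P ω) s, 1 - cdf (P ω) t])
        (dirichletMeasure α) μ := by
  have hA : ∀ (Q : Measure ℝ) [IsProbabilityMeasure Q],
      (fun i => Q.real ((![Set.Iic s, Set.Ioc s t, Set.Ioi t] : Fin 3 → Set ℝ) i)) =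
        ![cdf Q s, cdf Q t - cdf Q s, 1 - cdf Q t] := by
    intro Q _
    funext i
    fin_cases i
    · simp [cdf_eq_real]
    · simp only [Fin.mk_one, Matrix.cons_val_one, Matrix.cons_val_zero, cdf_eq_real]
      rw [← measureReal_sdiff (Set.Iic_subset_Iic.2 hst) measurableSet_Iic]
      congr 1
      ext x
      simp [and_comm]
    · simp only [Fin.reduceFinMk, Matrix.cons_val, cdf_eq_real]
      rw [← Set.compl_Iic, probReal_compl_eq_one_sub measurableSet_Iic]
  have hprob := hP.isProbabilityMeasure
  have hlaw := hP.hasLaw 3 (by norm_num) ![Set.Iic s, Set.Ioc s t, Set.Ioi t]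
    (by intro i; fin_cases i <;> simp)
    (by
      intro i j hij
      fin_cases i <;> fin_cases j <;>
        simp [Set.disjoint_left] at hij ⊢ <;> intros <;> linarith)
    (by
      ext x
      simp only [Set.mem_iUnion, Set.mem_univ, iff_true]
      rcases le_or_gt x s with h | h
      · exact ⟨0, h⟩
      · rcases le_or_gt x t with h' | h'
        · exact ⟨1, h, h'⟩
        · exact ⟨2, h'⟩)
  rw [funext fun ω => hA (P ω)] at hlaw
  have hAH := fun i => congrFun (hA H) i
  refine ⟨_, fun i => mul_nonneg ha.le measureReal_nonneg, ?_, ?_, ?_, hlaw⟩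
  · rw [← Finset.mul_sum, Finset.sum_congr rfl fun i _ => hAH i]
    simp [Fin.sum_univ_three]
  · rw [hAH]; simp
  · rw [hAH]; simp

lemma lintegral_adIntegrand (hP : IsDirichletProcess P a H μ) (ha : 0 < a) {t : ℝ}
    (ht : cdf H t ∈ Set.Ioo (0 : ℝ) 1) :
    ∫⁻ ω, adIntegrand P H ω t ∂μ = ENNReal.ofReal (1 / (a + 1)) := by
  obtain ⟨α, hα, hsum, h0, -, hlaw⟩ := hP.hasLaw_Iic_Ioc_Ioi ha le_rfl (s := t)
  have h1 : 0 < 1 - cdf H t := sub_pos.2 ht.2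
  have h2 : 0 < cdf H t := ht.1
  have key := hlaw.lintegral_comp (f := fun x => ENNReal.ofReal ((x 0 - cdf H t) ^ 2) *
    ENNReal.ofReal (cdf H t * (1 - cdf H t))⁻¹) (Measurable.aemeasurable (by fun_prop))
  have e : ∀ ω, adIntegrand P H ω t = ENNReal.ofReal ((cdf (P ω) t - cdf H t) ^ 2) *
      ENNReal.ofReal (cdf H t * (1 - cdf H t))⁻¹ := fun ω => by
    rw [adIntegrand_eq_ofReal ω ht, div_eq_mul_inv, ENNReal.ofReal_mul (sq_nonneg _)]
  simp_rw [e]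
  refine key.trans ?_
  rw [lintegral_mul_const _ (by fun_prop), lintegral_sq_dirichletMeasure ha hα hsum h0,
    ← ENNReal.ofReal_mul (by positivity)]
  congr 1
  field_simp

/-- At `s ≤ t` the deviation of `P` from `H` is that of the mass of `(-∞, s]` at `s`, and minus that
of the mass of `(t, ∞)` at `t`, so this is a moment of the outer coordinates of a Dirichlet
vector. -/
lemma lintegral_adIntegrand_mul (hP : IsDirichletProcess P a H μ) (ha : 0 < a) {s t : ℝ}
    (hst : s ≤ t) (hs : cdf H s ∈ Set.Ioo (0 : ℝ) 1) (ht : cdf H t ∈ Set.Ioo (0 : ℝ) 1) :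
    ∫⁻ ω, adIntegrand P H ω s * adIntegrand P H ω t ∂μ =
      ENNReal.ofReal (adMixedMoment a (cdf H s) (cdf H t)) := by
  obtain ⟨α, hα, hsum, h0, h2, hlaw⟩ := hP.hasLaw_Iic_Ioc_Ioi ha hst
  have hs1 : 0 < 1 - cdf H s := sub_pos.2 hs.2
  have hs0 : 0 < cdf H s := hs.1
  have ht1 : 0 < 1 - cdf H t := sub_pos.2 ht.2
  have ht0 : 0 < cdf H t := ht.1
  have hc : 0 ≤ (cdf H s * (1 - cdf H s) * (cdf H t * (1 - cdf H t)))⁻¹ := by positivity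
  have key := hlaw.lintegral_comp (f := fun x =>
    ENNReal.ofReal ((x 0 - cdf H s) ^ 2 * (x 2 - (1 - cdf H t)) ^ 2) *
    ENNReal.ofReal (cdf H s * (1 - cdf H s) * (cdf H t * (1 - cdf H t)))⁻¹)
    (Measurable.aemeasurable (by fun_prop))
  have e : ∀ ω, adIntegrand P H ω s * adIntegrand P H ω t =
      ENNReal.ofReal ((cdf (P ω) s - cdf H s) ^ 2 *
        ((1 - cdf (P ω) t) - (1 - cdf H t)) ^ 2) *
      ENNReal.ofReal (cdf H s * (1 - cdf H s) * (cdf H t * (1 - cdf H t)))⁻¹ := fun ω => by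
    rw [adIntegrand_eq_ofReal ω ht, adIntegrand_eq_ofReal ω hs,
      ← ENNReal.ofReal_mul (by positivity), ← ENNReal.ofReal_mul (by positivity)]
    congr 1
    field_simp
    ring
  simp_rw [e]
  refine key.trans ?_
  rw [lintegral_mul_const _ (by fun_prop), lintegral_sq_mul_sq_dirichletMeasure ha hα hsum h0 h2,
    ← ENNReal.ofReal_mul' hc, ← div_eq_mul_inv, adMixedMoment_eq hs0 hs.2 ht0 ht.2]

/-- The points where the weight `F (1 - F)` vanishes are negligible. -/
lemma ae_cdf_mem_Ioo (hH : Continuous (cdf H)) : ∀ᵐ t ∂H, cdf H t ∈ Set.Ioo (0 : ℝ) 1 := by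
  have : ∀ᵐ u ∂H.map (cdf H), u ∈ Set.Ioo (0 : ℝ) 1 := by
    rw [map_cdf_eq_restrict_volume hH]
    exact ae_restrict_mem measurableSet_Ioo
  exact ae_of_ae_map hH.measurable.aemeasurable this

/-! ### The first two moments of the distance -/

lemma lintegral_andersonDarling [IsProbabilityMeasure μ] (hP : IsDirichletProcess P a H μ)
    (ha : 0 < a) (hH : Continuous (cdf H)) :
    ∫⁻ ω, andersonDarling (cdf (P ω)) (cdf H) ∂μ = ENNReal.ofReal (1 / (a + 1)) := by
  simp_rw [andersonDarling_eq_lintegral_adIntegrand]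
  rw [lintegral_lintegral_swap (measurable_adIntegrand hP).aemeasurable,
    lintegral_congr_ae ((ae_cdf_mem_Ioo hH).mono fun t ht => lintegral_adIntegrand hP ha ht)]
  simp

lemma lintegral_andersonDarling_sq [IsProbabilityMeasure μ] (hP : IsDirichletProcess P a H μ)
    (ha : 0 < a) (hH : Continuous (cdf H)) :
    ∫⁻ ω, andersonDarling (cdf (P ω)) (cdf H) ^ 2 ∂μ =
      ENNReal.ofReal (2 * ((2 * a - 6) * (Real.pi ^ 2 / 6) + 5 / 2 * (6 - a)) /
        ((a + 1) * (a + 2) * (a + 3))) := by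
  have hm := measurable_adIntegrand hP
  have hmω : ∀ ω, Measurable (adIntegrand P H ω) := fun ω => hm.of_uncurry_left
  have hm1 : Measurable fun q : Ω × ℝ × ℝ => adIntegrand P H q.1 q.2.1 :=
    hm.comp (g := Function.uncurry (adIntegrand P H)) (f := fun q : Ω × ℝ × ℝ => (q.1, q.2.1))
      (by fun_prop)
  have hm2 : Measurable fun q : Ω × ℝ × ℝ => adIntegrand P H q.1 q.2.2 :=
    hm.comp (g := Function.uncurry (adIntegrand P H)) (f := fun q : Ω × ℝ × ℝ => (q.1, q.2.2))
      (by fun_prop)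
  have hm3 : Measurable fun q : Ω × ℝ × ℝ =>
      adIntegrand P H q.1 q.2.1 * adIntegrand P H q.1 q.2.2 := hm1.mul hm2
  have hsq : ∀ ω, andersonDarling (cdf (P ω)) (cdf H) ^ 2 =
      ∫⁻ q, adIntegrand P H ω q.1 * adIntegrand P H ω q.2 ∂H.prod H := fun ω => by
    rw [andersonDarling_eq_lintegral_adIntegrand, sq,
      lintegral_prod_mul (hmω ω).aemeasurable (hmω ω).aemeasurable]
  have hae : ∀ᵐ q ∂H.prod H, ∫⁻ ω, adIntegrand P H ω q.1 * adIntegrand P H ω q.2 ∂μ =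
      symmAdMixedMoment a (Prod.map (cdf H) (cdf H) q) := by
    filter_upwards [Measure.quasiMeasurePreserving_fst.ae (ae_cdf_mem_Ioo hH),
      Measure.quasiMeasurePreserving_snd.ae (ae_cdf_mem_Ioo hH)] with q h1 h2
    simp only [symmAdMixedMoment, Prod.map_fst, Prod.map_snd]
    rcases le_total q.1 q.2 with h | h
    · rw [min_eq_left (monotone_cdf H h), max_eq_right (monotone_cdf H h),
        lintegral_adIntegrand_mul hP ha h h1 h2]
    · simp_rw [mul_comm (adIntegrand P H _ q.1)]
      rw [min_eq_right (monotone_cdf H h), max_eq_left (monotone_cdf H h),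
        lintegral_adIntegrand_mul hP ha h h2 h1]
  have hc : Measurable (cdf H) := hH.measurable
  calc ∫⁻ ω, andersonDarling (cdf (P ω)) (cdf H) ^ 2 ∂μ
      = ∫⁻ ω, ∫⁻ q, adIntegrand P H ω q.1 * adIntegrand P H ω q.2 ∂H.prod H ∂μ :=
        lintegral_congr hsq
    _ = ∫⁻ q, ∫⁻ ω, adIntegrand P H ω q.1 * adIntegrand P H ω q.2 ∂μ ∂H.prod H :=
        lintegral_lintegral_swap hm3.aemeasurable
    _ = ∫⁻ q, symmAdMixedMoment a (Prod.map (cdf H) (cdf H) q) ∂H.prod H := lintegral_congr_ae hae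
    _ = ∫⁻ p, symmAdMixedMoment a p ∂(H.prod H).map (Prod.map (cdf H) (cdf H)) :=
        (lintegral_map (measurable_symmAdMixedMoment a) (hc.prodMap hc)).symm
    _ = ∫⁻ p, symmAdMixedMoment a p ∂unitSquareMeasure := by
        rw [← Measure.map_prod_map _ _ hc hc, map_cdf_eq_restrict_volume hH, unitSquareMeasure]
    _ = _ := lintegral_symmAdMixedMoment ha

end DirichletProcess

theorem mainTheorem1 {Ω : Type*} [MeasurableSpace Ω] (μ : Measure Ω) [IsProbabilityMeasure μ]
    (a : ℝ) (ha : 0 < a) (H : Measure ℝ) [IsProbabilityMeasure H] (hH : Continuous (cdf H))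
    (P : Ω → Measure ℝ) (hP : IsDirichletProcess P a H μ) :
    (∀ᵐ ω ∂μ, andersonDarling (cdf (P ω)) (cdf H) < ∞) ∧
    MemLp (fun ω => (andersonDarling (cdf (P ω)) (cdf H)).toReal) 2 μ ∧
    ∫ ω, (andersonDarling (cdf (P ω)) (cdf H)).toReal ∂μ = 1 / (a + 1) ∧
    variance (fun ω => (andersonDarling (cdf (P ω)) (cdf H)).toReal) μ =
      2 * ((Real.pi ^ 2 - 9) * a ^ 2 + (30 - 2 * Real.pi ^ 2) * a - 3 * Real.pi ^ 2 + 36) /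
        (3 * (a + 1) ^ 2 * (a + 2) * (a + 3)) := by
  have hmeas : Measurable fun ω => andersonDarling (cdf (P ω)) (cdf H) := by
    simp_rw [andersonDarling_eq_lintegral_adIntegrand]
    exact (measurable_adIntegrand hP).lintegral_prod_right'
  have h1 := lintegral_andersonDarling hP ha hH
  have h2 := lintegral_andersonDarling_sq hP ha hH
  have hfin : ∀ᵐ ω ∂μ, andersonDarling (cdf (P ω)) (cdf H) < ∞ :=
    ae_lt_top hmeas (by rw [h1]; exact ENNReal.ofReal_ne_top)
  have hsqfin : ∀ᵐ ω ∂μ, andersonDarling (cdf (P ω)) (cdf H) ^ 2 < ∞ :=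
    hfin.mono fun ω h => ENNReal.pow_lt_top h
  have hLp : MemLp (fun ω => (andersonDarling (cdf (P ω)) (cdf H)).toReal) 2 μ := by
    rw [memLp_two_iff_integrable_sq hmeas.ennreal_toReal.aestronglyMeasurable]
    simp_rw [← ENNReal.toReal_pow]
    exact integrable_toReal_of_lintegral_ne_top (hmeas.pow_const 2).aemeasurable
      (by rw [h2]; exact ENNReal.ofReal_ne_top)
  have hmean : ∫ ω, (andersonDarling (cdf (P ω)) (cdf H)).toReal ∂μ = 1 / (a + 1) := by
    rw [integral_toReal hmeas.aemeasurable hfin, h1, ENNReal.toReal_ofReal (by positivity)]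
  refine ⟨hfin, hLp, hmean, ?_⟩
  have hsecond : ∫ ω, (andersonDarling (cdf (P ω)) (cdf H)).toReal ^ 2 ∂μ =
      2 * ((2 * a - 6) * (Real.pi ^ 2 / 6) + 5 / 2 * (6 - a)) /
        ((a + 1) * (a + 2) * (a + 3)) := by
    simp_rw [← ENNReal.toReal_pow]
    rw [integral_toReal (hmeas.pow_const 2).aemeasurable hsqfin, h2, ENNReal.toReal_ofReal]
    -- the bracket equals `a (π² / 3 - 5 / 2) + (15 - π²)`, and `9 < π² < 10`
    have hpi1 : 9 < Real.pi ^ 2 := by nlinarith [Real.pi_gt_three]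
    have hpi2 : Real.pi ^ 2 < 10 := by nlinarith [Real.pi_gt_three, Real.pi_lt_d2]
    have : 0 ≤ (2 * a - 6) * (Real.pi ^ 2 / 6) + 5 / 2 * (6 - a) := by
      nlinarith [mul_pos ha (sub_pos.2 hpi1)]
    positivity
  rw [variance_eq_sub hLp, hmean]
  simp only [Pi.pow_apply]
  rw [hsecond]
  field_simp
  ring
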